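/- Consider a platoon of $N\ge 2$ identical vehicles $1,\dots,N$, vehicle $1$ being the leader. All vehicles have the same transfer function $b(s)/a(s)$ and the same onboard controller $q(s)/p(s)$, where $a,b,p,q$ are real polynomials of arbitrary degree and $a,p\neq 0$; let $M(s)=\frac{b(s)q(s)}{a(s)p(s)}$ be the open loop. The positions are $y_i=M e_i$, where $e_1=r_1$, $e_i=(y_{i-1}-y_i)-\varepsilon_i(y_i-y_{i+1})+r_i$ for $1<i<N$, $e_N=(y_{N-1}-y_N)+r_N$, with arbitrary weights $\varepsilon_i\ge 0$ and external inputs $r_i$. Thus $e=-Ly+r$, where $L$ is the Laplacian of the path graph, and $y=(I+ML)^{-1}M\,r$; let $T_{c,o}=y_o/r_c$ be the transfer function from the input of vehicle $c$ to the position of vehicle $o$. For a rational function $G$ put $\|G\|_\infty=\sup_{\omega\ge 0}|G(\jmath\omega)|$. Assume that $M$ has at least one integrator (a pole at $s=0$) and that the platoon behind the leader is asymptotically stable: all roots of $\det(a p\, I+b q\,\bar L)$ have negative real part, where $\bar L$ is $L$ without the row and column of the leader. Let $\lambda_{\max}$ be an upper bound on the eigenvalues of $L$, and let $$T_{\max}(s)=\frac{\lambda_{\max}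 b(s)q(s)}{a(s)p(s)+\lambda_{\max} b(s)q(s)}$$ be the single-agent closed loop with gain $\lambda_{\max}$. If $\|T_{\max}\|_\infty=1$, then $\|T_{c,o}\|_\infty=|T_{c,o}(0)|$ for every control vehicle $c\in\{2,\dots,N\}$ and every output vehicle $o$, and the platoon is bidirectionally string-stable: for every control vehicle $c$, with $y_o=T_{c,o}r_c$, $$\left\|\frac{y_o}{y_{o-1}}\right\|_\infty\le 1\ \text{ for all } c<o\le N,\qquad \left\|\frac{y_{o-1}}{y_o}\right\|_\infty\le 1\ \text{ for all } 2\le o\le c.$$ (If $y_o$ vanishes identically in the second family, as it can when some $\varepsilon_i=0$, then so does $y_{o-1}$, and the ratio counts as $0$.) -/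

import Mathlib

open scoped Polynomial ENNReal

noncomputable section

namespace Platoon

/-- The identical agents of the platoon: a vehicle `b(s)/a(s)` driven by a dynamic onboard
controller `q(s)/p(s)`, of arbitrary type and order. -/
structure Agent where
  /-- numerator `b` of the vehicle -/
  vehNum : ℝ[X]
  /-- denominator `a` of the vehicle -/
  vehDen : ℝ[X]
  /-- numerator `q` of the controller -/
  ctrlNum : ℝ[X]
  /-- denominator `p` of the controller -/
  ctrlDen : ℝ[X]
  vehDen_ne_zero : vehDen ≠ 0
  ctrlDen_ne_zero : ctrlDen ≠ 0

namespace Agent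

/-- The vehicle transfer function. -/
def vehicle (A : Agent) : RatFunc ℝ :=
  algebraMap ℝ[X] (RatFunc ℝ) A.vehNum / algebraMap ℝ[X] (RatFunc ℝ) A.vehDen

/-- The controller transfer function. -/
def controller (A : Agent) : RatFunc ℝ :=
  algebraMap ℝ[X] (RatFunc ℝ) A.ctrlNum / algebraMap ℝ[X] (RatFunc ℝ) A.ctrlDen

/-- The open-loop model: series connection of the controller and the vehicle. -/
def openLoop (A : Agent) : RatFunc ℝ := A.controller * A.vehicle

/-- The closed loop `T_g(s) = g b q / (a p + g b q)` of a single agent with the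
proportional gain `g`. -/
def closedLoop (A : Agent) (g : ℝ) : RatFunc ℝ :=
  algebraMap ℝ[X] (RatFunc ℝ) (Polynomial.C g * (A.vehNum * A.ctrlNum)) /
    algebraMap ℝ[X] (RatFunc ℝ)
      (A.vehDen * A.ctrlDen + Polynomial.C g * (A.vehNum * A.ctrlNum))

end Agent

/-- The number of integrators of `G`: the order of its pole at `s = 0`, i.e. the least `k` for
which `s ^ k * G(s)` is finite at `s = 0` (`denom` is the denominator in lowest terms). -/
def numIntegrators (G : RatFunc ℝ) : ℕ := G.denom.rootMultiplicity 0

/-- The value `G(s)` at a complex number `s` that is not a pole of `G`. -/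
def evalAt (G : RatFunc ℝ) (s : ℂ) : ℂ := G.eval (algebraMap ℝ ℂ) s

open Classical in
/-- The norm `sup_{ω ≥ 0} |G(jω)|`, with `|G(jω)| = ∞` where `jω` is a pole of `G`. -/
def hinfNorm (G : RatFunc ℝ) : ℝ≥0∞ :=
  ⨆ ω : ℝ, ⨆ _ : 0 ≤ ω,
    if Polynomial.aeval (Complex.I * (ω : ℂ)) G.denom = 0 then ∞
    else ‖evalAt G (Complex.I * (ω : ℂ))‖ₑ

open Classical in
/-- The norm of the ratio `F / G` of two signals. If `G` vanishes identically, it is infinite,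
unless `F` vanishes identically as well. -/
def ratioNorm (F G : RatFunc ℝ) : ℝ≥0∞ :=
  if G = 0 then (if F = 0 then 0 else ∞) else hinfNorm (F / G)

/-- The Laplacian of the platoon of `N` vehicles. Vehicle `k` (`k = 1, …, N`) has the
index `k - 1 : Fin N`; index `0` is the leader. `ε i` is the constant of bidirectionality of the
vehicle with index `i`; those of the leader and of the last vehicle do not enter. -/
def laplacian {N : ℕ} (ε : Fin N → ℝ) : Matrix (Fin N) (Fin N) ℝ := fun i j =>
  if i.val = 0 then 0
  else if j.val + 1 = i.val then -1
  else if j.val = i.val then (if i.val + 1 < N then 1 + ε i else 1)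
  else if j.val = i.val + 1 then -ε i
  else 0

/-- The Laplacian with the row and the column of the leader deleted. -/
def reducedLaplacian {N : ℕ} (ε : Fin N → ℝ) :
    Matrix {i : Fin N // i.val ≠ 0} {i : Fin N // i.val ≠ 0} ℝ :=
  (laplacian ε).submatrix Subtype.val Subtype.val

/-- The characteristic polynomial `det (a p I + b q L̄)` of the interconnected followers. -/
def charPoly {N : ℕ} (A : Agent) (ε : Fin N → ℝ) : ℝ[X] :=
  ((A.vehDen * A.ctrlDen) • (1 : Matrix {i : Fin N // i.val ≠ 0} {i : Fin N // i.val ≠ 0} ℝ[X]) +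
    (A.vehNum * A.ctrlNum) • (reducedLaplacian ε).map Polynomial.C).det

/-- Asymptotic stability of the platoon behind the independently driven leader. -/
def AsymptoticallyStable {N : ℕ} (A : Agent) (ε : Fin N → ℝ) : Prop :=
  ∀ s : ℂ, Polynomial.aeval s (charPoly A ε) = 0 → s.re < 0

/-- The transfer function matrix from the external inputs `r` to the positions `y`: the
interconnection `y = M e`, `e = -L y + r` gives `y = (I + M L)⁻¹ M r`. -/
def transferMatrix {N : ℕ} (A : Agent) (ε : Fin N → ℝ) : Matrix (Fin N) (Fin N) (RatFunc ℝ) :=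
  (1 + A.openLoop • (laplacian ε).map RatFunc.C)⁻¹ * (A.openLoop • 1)

/-- The transfer function `T_{c,o}` from the input `r_c` of the control vehicle `c` to the
position `y_o` of the output vehicle `o`. -/
def transfer {N : ℕ} (A : Agent) (ε : Fin N → ℝ) (c o : Fin N) : RatFunc ℝ :=
  transferMatrix A ε o c

/-- Bidirectional string stability: the effect of an input acting at any vehicle `c` does not
grow from a vehicle to the next one farther away from `c`, behind `c` and ahead of `c`.
Here `i` is the immediate predecessor of `o`, and `y_o / y_i = T_{c,o} / T_{c,i}`. -/
def BidirectionallyStringStable {N : ℕ} (A : Agent) (ε : Fin N → ℝ) : Prop :=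
  ∀ c i o : Fin N, i.val + 1 = o.val →
    (c < o → ratioNorm (transfer A ε c o) (transfer A ε c i) ≤ 1) ∧
    (o ≤ c → ratioNorm (transfer A ε c i) (transfer A ε c o) ≤ 1)

end Platoon

end

/-!
Write `P = a p` and `Q = b q`, so that the platoon obeys `(P + Q L) y = Q r`. The argument compares
every transfer function on the imaginary axis with its value at `s = 0`, where `P = 0`.

The Laplacian is tridiagonal, and Gaussian elimination from both ends (`elim_backward`,
`elim_forward`, `elim_at`) involves its off-diagonal entries only through the products
`ε k` of opposite ones. The eliminated unknowns are expressed by continuants, that is, by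
determinants of contiguous diagonal blocks of `P + Q L`. Consequently nothing changes if `L` is
replaced by the symmetric matrix with off-diagonal entries `-√(ε k)`, even where `ε k = 0` and the
two matrices are not similar. In particular both have the same spectrum
(`spectrum_symTriMatrix`), so a bound on the eigenvalues of `L` bounds the symmetric matrix as a
quadratic form, hence also all its principal blocks (`le_of_mem_spectrum_block`).

The quotients `y_o / y_{o-1}` behind the control vehicle, `y_{o-1} / y_o` ahead of it, and
`T_{c,c}` itself all turn out to be a nonnegative constant times a diagonal entry of
`Q (P + Q H)⁻¹`, with `H` a contiguous block of the symmetric matrix (`transfer_behind`,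
`transfer_ahead`, `transfer_self`). By the spectral theorem such an entry is
`∑ w_j Q / (P + λ_j Q)` with `w_j ≥ 0` and `0 < λ_j ≤ λ_max`. The hypothesis on `T_max` says
`|P + λ_max Q| ≥ λ_max |Q|` on the imaginary axis; this is inherited by every smaller positive
gain (`mul_norm_le_of_le`), so each summand is at most `w_j / λ_j` in modulus, which is its value at
`s = 0` (`norm_pencilContinuant_div_le`). Hence the three kinds of transfer functions attain their
norm at `s = 0`, and so do their products, among which are all the `T_{c,o}`. At `s = 0` the
continuants satisfy a first-order recursion (`pencilContinuant_zero_one_succ`), which evaluates the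
quotients to `1` behind the control vehicle and to at most `1` ahead of it.
-/

noncomputable section

namespace Platoon

/-! ### Continuants and elimination in tridiagonal systems -/

section Tridiagonal

variable {R : Type*} [CommRing R]

/-- The continuant of length `m` starting at the index `a`: the determinant of the tridiagonal
matrix with diagonal entries `d a, …, d (a + m - 1)` in which `e k` is the product of the
entries at `(k, k + 1)` and `(k + 1, k)`. The recursion expands along the first row. -/
def continuant (d e : ℕ → R) : ℕ → ℕ → R
  | _, 0 => 1
  | a, 1 => d a
  | a, m + 2 => d a * continuant d e (a + 1) (m + 1) - e a * continuant d e (a + 2) m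

theorem continuant_zero (d e : ℕ → R) (a : ℕ) : continuant d e a 0 = 1 := by
  rw [continuant]

theorem continuant_one (d e : ℕ → R) (a : ℕ) : continuant d e a 1 = d a := by
  rw [continuant]

theorem continuant_succ_succ (d e : ℕ → R) (a m : ℕ) :
    continuant d e a (m + 2) =
      d a * continuant d e (a + 1) (m + 1) - e a * continuant d e (a + 2) m := by
  rw [continuant]

/-- Euler's identity: a continuant cut between the indices `a + m` and `a + m + 1`. -/
theorem continuant_split (d e : ℕ → R) (a m n : ℕ) :
    continuant d e a (m + n + 2) =
      continuant d e a (m + 1) * continuant d e (a + m + 1) (n + 1) -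
        e (a + m) * continuant d e a m * continuant d e (a + m + 2) n := by
  induction m using Nat.strong_induction_on generalizing a with
  | _ m ih =>
    match m, ih with
    | 0, _ =>
      simp [continuant_zero, continuant_one, continuant_succ_succ]
    | 1, ih =>
      have h := ih 0 (by omega) (a + 1)
      have e1 : 1 + n + 2 = (n + 1) + 2 := by ring
      have e2 : a + 1 + 0 + 1 = a + 2 := by ring
      rw [e1, continuant_succ_succ, show n + 1 + 1 = 0 + n + 2 by ring, h, continuant_succ_succ,
        e2]
      simp only [continuant_zero, continuant_one, Nat.add_zero]
      rw [show a + 1 + 0 + 2 = a + 1 + 2 by ring, show a + 1 + 1 = a + 2 by ring,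
        show 0 + 1 = 1 from rfl, continuant_one]
      ring
    | k + 2, ih =>
      have h1 := ih (k + 1) (by omega) (a + 1)
      have h2 := ih k (by omega) (a + 2)
      rw [show k + 2 + n + 2 = (k + n + 2) + 2 by ring, continuant_succ_succ,
        show k + n + 2 + 1 = k + 1 + n + 2 by ring, h1, h2, continuant_succ_succ d e a (k + 1),
        continuant_succ_succ d e a k, show a + 1 + (k + 1) = a + (k + 2) by ring,
        show a + 2 + k = a + (k + 2) by ring]
      ring

/-- The three-term recursion at the far end. -/
theorem continuant_succ_succ' (d e : ℕ → R) (a m : ℕ) :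
    continuant d e a (m + 2) =
      d (a + m + 1) * continuant d e a (m + 1) - e (a + m) * continuant d e a m := by
  have h := continuant_split d e a m 0
  rw [Nat.add_zero] at h
  rw [h, Nat.zero_add, continuant_one, continuant_zero]
  ring

theorem continuant_shift (d e : ℕ → R) (b a m : ℕ) :
    continuant (fun k => d (b + k)) (fun k => e (b + k)) a m = continuant d e (b + a) m := by
  induction m using Nat.strong_induction_on generalizing a with
  | _ m ih =>
    match m, ih with
    | 0, _ => simp [continuant_zero]
    | 1, _ => simp [continuant_one]
    | k + 2, ih =>
      rw [continuant_succ_succ, continuant_succ_succ, ih _ (by omega), ih _ (by omega)]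
      rfl

theorem continuant_congr {d d' e e' : ℕ → R} {a m : ℕ}
    (hd : ∀ k, a ≤ k → k < a + m → d k = d' k) (he : ∀ k, a ≤ k → k + 1 < a + m → e k = e' k) :
    continuant d e a m = continuant d' e' a m := by
  induction m using Nat.strong_induction_on generalizing a with
  | _ m ih =>
    match m, ih with
    | 0, _ => simp [continuant_zero]
    | 1, _ => simpa [continuant_one] using hd a le_rfl (by omega)
    | k + 2, ih =>
      rw [continuant_succ_succ, continuant_succ_succ,
        ih _ (by omega) (fun j h1 h2 => hd j (by omega) (by omega))
          (fun j h1 h2 => he j (by omega) (by omega)),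
        ih _ (by omega) (fun j h1 h2 => hd j (by omega) (by omega))
          (fun j h1 h2 => he j (by omega) (by omega)), hd a le_rfl (by omega),
        he a le_rfl (by omega)]

theorem map_continuant {S : Type*} [CommRing S] (f : R →+* S) (d e : ℕ → R) (a m : ℕ) :
    f (continuant d e a m) = continuant (fun k => f (d k)) (fun k => f (e k)) a m := by
  induction m using Nat.strong_induction_on generalizing a with
  | _ m ih =>
    match m, ih with
    | 0, _ => simp [continuant_zero]
    | 1, _ => simp [continuant_one]
    | k + 2, ih =>
      rw [continuant_succ_succ, continuant_succ_succ, map_sub, map_mul, map_mul,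
        ih _ (by omega), ih _ (by omega)]

/-- The tridiagonal matrix whose row `i` has the diagonal entry `d i`, the entry `-s i` left of it
and the entry `-t i` right of it. -/
def triMatrix (n : ℕ) (d s t : ℕ → R) : Matrix (Fin n) (Fin n) R := fun i j =>
  if j.val = i.val then d i
  else if j.val + 1 = i.val then -s i
  else if j.val = i.val + 1 then -t i
  else 0

theorem det_triMatrix (n : ℕ) (d s t : ℕ → R) :
    (triMatrix n d s t).det = continuant d (fun k => t k * s (k + 1)) 0 n := by
  induction n using Nat.strong_induction_on generalizing d s t with
  | _ n ih =>
    match n, ih with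
    | 0, _ => simp [continuant_zero]
    | 1, _ => simp [continuant_one, triMatrix]
    | n + 2, ih =>
      have h1 : (triMatrix (n + 2) d s t).submatrix Fin.succ (Fin.succAbove 0) =
          triMatrix (n + 1) (fun k => d (1 + k)) (fun k => s (1 + k)) (fun k => t (1 + k)) := by
        ext i j
        simp [triMatrix, Nat.add_comm 1]
      have h2 : (triMatrix (n + 2) d s t).submatrix (fun i : Fin n => i.succ.succ)
            (fun j : Fin n => j.succ.succ) =
          triMatrix n (fun k => d (2 + k)) (fun k => s (2 + k)) (fun k => t (2 + k)) := by
        ext i j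
        simp [triMatrix, Nat.add_comm 2]
      have h3 : ((triMatrix (n + 2) d s t).submatrix Fin.succ (Fin.succAbove 1)).det =
          -s 1 * continuant d (fun k => t k * s (k + 1)) 2 n := by
        rw [Matrix.det_succ_column_zero, Fin.sum_univ_succ, Finset.sum_eq_zero, add_zero]
        · have : ((triMatrix (n + 2) d s t).submatrix Fin.succ (Fin.succAbove 1)).submatrix
              (Fin.succAbove 0) Fin.succ = (triMatrix (n + 2) d s t).submatrix
                (fun i : Fin n => i.succ.succ) (fun j : Fin n => j.succ.succ) := by
            ext i j
            simp [Fin.succAbove, Fin.lt_def]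
          rw [this, h2, ih n (by omega), ← continuant_shift _ _ 2 0]
          simp [triMatrix, Fin.succAbove, add_assoc]
        · intro i _
          simp [triMatrix, Fin.succAbove]
      rw [Matrix.det_succ_row_zero, Fin.sum_univ_succ, Fin.sum_univ_succ, Finset.sum_eq_zero,
        add_zero, h1, ih _ (by omega), continuant_succ_succ]
      · have h4 : (Fin.succ (0 : Fin (n + 1))) = 1 := rfl
        have h5 := continuant_shift d (fun k => t k * s (k + 1)) 1 0 (n + 1)
        rw [h4, h3]
        simp only [add_assoc] at h5 ⊢
        rw [h5]
        simp [triMatrix]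
        ring
      · intro i _
        simp [triMatrix]

/-- The vector `x` moved up by one index and extended by zero, so that `pad x (i + 1) = x i` and
the boundary rows of a tridiagonal system look like the others. -/
def pad {n : ℕ} (x : Fin n → R) : ℕ → R
  | 0 => 0
  | k + 1 => if h : k < n then x ⟨k, h⟩ else 0

theorem pad_succ {n : ℕ} (x : Fin n → R) (i : Fin n) : pad x (i.val + 1) = x i := by
  simp [pad]

theorem triMatrix_mulVec {n : ℕ} (d s t : ℕ → R) (x : Fin n → R) (i : Fin n) :
    (triMatrix n d s t).mulVec x i =
      d i * pad x (i + 1) - s i * pad x i - t i * pad x (i + 2) := by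
  have h : ∀ j : Fin n, triMatrix n d s t i j * x j =
      (if j.val = i.val then d i * pad x (j + 1) else 0) -
      (if j.val + 1 = i.val then s i * pad x (j + 1) else 0) -
      (if j.val = i.val + 1 then t i * pad x (j + 1) else 0) := by
    intro j
    rw [pad_succ]
    unfold triMatrix
    split_ifs <;> first | omega | simp
  rw [Matrix.mulVec, dotProduct, Finset.sum_congr rfl fun j _ => h j, Finset.sum_sub_distrib,
    Finset.sum_sub_distrib]
  congr 1
  · congr 1
    · rw [Finset.sum_eq_single i]
      · simp
      · intro j _ hj
        rw [if_neg fun h => hj (Fin.ext h)]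
      · simp
    · obtain ⟨i, hi⟩ := i
      cases i with
      | zero => simp [pad]
      | succ k =>
        rw [Finset.sum_eq_single ⟨k, by omega⟩]
        · simp
        · intro j _ hj
          rw [if_neg fun h => hj (Fin.ext (by simpa using h))]
        · simp
  · by_cases hi : i.val + 1 < n
    · rw [Finset.sum_eq_single ⟨i.val + 1, hi⟩]
      · simp
      · intro j _ hj
        rw [if_neg fun h => hj (Fin.ext h)]
      · simp
    · rw [Finset.sum_eq_zero]
      · simp [pad, hi]
      · intro j _
        rw [if_neg]
        omega

section Elimination

variable {n : ℕ} {d s t r : ℕ → R} {x : Fin n → R}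

/-- Elimination from the last row up to row `k`, below which the system is homogeneous. -/
theorem elim_backward (hx : ∀ i : Fin n, (triMatrix n d s t).mulVec x i = r i) {k m : ℕ}
    (hk : k + m + 1 = n) (hr : ∀ j, k ≤ j → r j = 0) :
    continuant d (fun k => t k * s (k + 1)) k (m + 1) * pad x (k + 1) =
      s k * continuant d (fun k => t k * s (k + 1)) (k + 1) m * pad x k := by
  induction m generalizing k with
  | zero =>
    have h := hx ⟨k, by omega⟩
    rw [triMatrix_mulVec, hr _ le_rfl] at h
    have h0 : pad x (k + 2) = 0 := by simp [pad]; omega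
    simp only [h0] at h
    rw [continuant_one, continuant_zero]
    linear_combination h
  | succ m ih =>
    have h := hx ⟨k, by omega⟩
    rw [triMatrix_mulVec, hr _ le_rfl] at h
    have h1 := ih (k := k + 1) (by omega) fun j hj => hr j (by omega)
    rw [continuant_succ_succ]
    simp only at h
    linear_combination continuant d (fun k => t k * s (k + 1)) (k + 1) (m + 1) * h + t k * h1

/-- Elimination from the first row down to row `k`, above which the system is homogeneous. -/
theorem elim_forward (hx : ∀ i : Fin n, (triMatrix n d s t).mulVec x i = r i) {k : ℕ}
    (hk : k < n) (hr : ∀ j, j ≤ k → r j = 0) :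
    continuant d (fun k => t k * s (k + 1)) 0 (k + 1) * pad x (k + 1) =
      t k * continuant d (fun k => t k * s (k + 1)) 0 k * pad x (k + 2) := by
  induction k with
  | zero =>
    have h := hx ⟨0, hk⟩
    rw [triMatrix_mulVec, hr _ le_rfl] at h
    have h0 : pad x 0 = 0 := rfl
    simp only [h0] at h
    rw [continuant_one, continuant_zero]
    linear_combination h
  | succ k ih =>
    have h := hx ⟨k + 1, by omega⟩
    rw [triMatrix_mulVec, hr _ le_rfl] at h
    have h1 := ih (by omega) fun j hj => hr j (by omega)
    rw [continuant_succ_succ']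
    simp only [Nat.zero_add] at h ⊢
    linear_combination continuant d (fun k => t k * s (k + 1)) 0 (k + 1) * h + s (k + 1) * h1

/-- Elimination from both ends towards the only inhomogeneous row `c`. -/
theorem elim_at (hx : ∀ i : Fin n, (triMatrix n d s t).mulVec x i = r i) {c m : ℕ}
    (hc : c + m + 1 = n) (hr : ∀ j, j ≠ c → r j = 0) :
    continuant d (fun k => t k * s (k + 1)) 0 n * pad x (c + 1) =
      r c * continuant d (fun k => t k * s (k + 1)) 0 c *
        continuant d (fun k => t k * s (k + 1)) (c + 1) m := by
  have h := hx ⟨c, by omega⟩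
  rw [triMatrix_mulVec] at h
  simp only at h
  set K := continuant d (fun k => t k * s (k + 1)) with hK
  have hleft : d c * K 0 c * pad x (c + 1) - s c * K 0 c * pad x c =
      K 0 (c + 1) * pad x (c + 1) := by
    cases c with
    | zero =>
      have h0 : pad x 0 = 0 := rfl
      rw [h0, hK, continuant_one, continuant_zero]
      ring
    | succ k =>
      have h1 := elim_forward hx (k := k) (by omega) fun j hj => hr j (by omega)
      rw [← hK] at h1
      have h2 : K 0 (k + 2) = d (k + 1) * K 0 (k + 1) - t k * s (k + 1) * K 0 k := by
        rw [hK, continuant_succ_succ', Nat.zero_add]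
      rw [h2]
      linear_combination -s (k + 1) * h1
  have hright : K 0 (c + 1) * K (c + 1) m * pad x (c + 1) -
      t c * K 0 c * (K (c + 1) m * pad x (c + 2)) = K 0 n * pad x (c + 1) := by
    cases m with
    | zero =>
      have h0 : pad x (c + 2) = 0 := by simp [pad]; omega
      have h1 : c + 1 = n := by omega
      rw [h0, show K 0 n = K 0 (c + 1) from congrArg (K 0) h1.symm, hK, continuant_zero]
      ring
    | succ m =>
      have h1 := elim_backward hx (k := c + 1) (m := m) (by omega) fun j hj => hr j (by omega)
      have h2 := continuant_split d (fun k => t k * s (k + 1)) 0 c m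
      rw [show c + m + 2 = n by omega] at h2
      simp only [Nat.zero_add] at h2
      rw [← hK] at h1 h2
      rw [h2]
      linear_combination -t c * K 0 c * h1
  linear_combination -hright - K (c + 1) m * hleft + K 0 c * K (c + 1) m * h

end Elimination

end Tridiagonal

/-! ### The symmetric tridiagonal matrix and its pencil -/

section Pencil

variable {R : Type*} [CommRing R] [Algebra ℝ R]

/-- The determinants of the contiguous blocks of the pencil `P + Q H`, where `H` is tridiagonal
with diagonal entries `1 + η k` and products `η k` of opposite off-diagonal entries. -/
def pencilContinuant (η : ℕ → ℝ) (P Q : R) : ℕ → ℕ → R :=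
  continuant (fun k => P + algebraMap ℝ R (1 + η k) * Q) (fun k => algebraMap ℝ R (η k) * Q ^ 2)

theorem pencilContinuant_zero (η : ℕ → ℝ) (P Q : R) (a : ℕ) :
    pencilContinuant η P Q a 0 = 1 :=
  continuant_zero _ _ _

theorem map_pencilContinuant {S : Type*} [CommRing S] [Algebra ℝ S] (f : R →ₐ[ℝ] S) (η : ℕ → ℝ)
    (P Q : R) (a m : ℕ) :
    f (pencilContinuant η P Q a m) = pencilContinuant η (f P) (f Q) a m := by
  have h := map_continuant (f : R →+* S) (fun k => P + algebraMap ℝ R (1 + η k) * Q)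
    (fun k => algebraMap ℝ R (η k) * Q ^ 2) a m
  simpa [pencilContinuant] using h

theorem pencilContinuant_shift (η : ℕ → ℝ) (P Q : R) (b a m : ℕ) :
    pencilContinuant (fun k => η (b + k)) P Q a m = pencilContinuant η P Q (b + a) m :=
  continuant_shift (fun k => P + algebraMap ℝ R (1 + η k) * Q)
    (fun k => algebraMap ℝ R (η k) * Q ^ 2) b a m

theorem pencilContinuant_zero_left (η : ℕ → ℝ) (Q : R) (a m : ℕ) :
    pencilContinuant η 0 Q a m =
      Q ^ m * algebraMap ℝ R (pencilContinuant η (0 : ℝ) 1 a m) := by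
  induction m using Nat.strong_induction_on generalizing a with
  | _ m ih =>
    match m, ih with
    | 0, _ => simp [pencilContinuant, continuant_zero]
    | 1, _ => simp [pencilContinuant, continuant_one, mul_comm]
    | k + 2, ih =>
      have h1 := ih (k + 1) (by omega) (a + 1)
      have h2 := ih k (by omega) (a + 2)
      unfold pencilContinuant at h1 h2 ⊢
      rw [continuant_succ_succ, continuant_succ_succ, h1, h2]
      simp only [map_add, map_sub, map_mul, map_one, map_zero, one_pow, mul_one,
        Algebra.algebraMap_self, RingHom.id_apply]
      ring

/-- For `P = 0`, `Q = 1` the three-term recursion has this first integral. -/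
theorem pencilContinuant_zero_one_succ (η : ℕ → ℝ) (a m : ℕ) :
    pencilContinuant η (0 : ℝ) 1 a (m + 1) =
      1 + η (a + m) * pencilContinuant η (0 : ℝ) 1 a m := by
  unfold pencilContinuant
  induction m with
  | zero => simp [continuant_zero, continuant_one]
  | succ m ih =>
    rw [continuant_succ_succ']
    simp only [Algebra.algebraMap_self, RingHom.id_apply, one_pow, mul_one, zero_add] at ih ⊢
    rw [add_assoc a m 1]
    linear_combination ih

theorem pencilContinuant_pos {η : ℕ → ℝ} (hη : ∀ k, 0 ≤ η k) {p : ℝ} (hp : 0 ≤ p) (a m : ℕ) :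
    0 < pencilContinuant η p 1 a m := by
  have key : ∀ m, 0 < pencilContinuant η p 1 a m ∧
      1 + η (a + m) * pencilContinuant η p 1 a m ≤ pencilContinuant η p 1 a (m + 1) := by
    unfold pencilContinuant
    intro m
    induction m with
    | zero => simp [continuant_zero, continuant_one, hp]
    | succ m ih =>
      obtain ⟨h1, h2⟩ := ih
      have h3 : 0 < continuant (fun k => p + algebraMap ℝ ℝ (1 + η k) * 1)
          (fun k => algebraMap ℝ ℝ (η k) * 1 ^ 2) a (m + 1) := by
        have := mul_nonneg (hη (a + m)) h1.le
        linarith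
      refine ⟨h3, ?_⟩
      rw [continuant_succ_succ']
      simp only [Algebra.algebraMap_self, RingHom.id_apply, one_pow, mul_one] at h1 h2 h3 ⊢
      rw [add_assoc a m 1]
      have := mul_nonneg hp h3.le
      linarith
  exact (key m).1

/-- The symmetric tridiagonal matrix with diagonal `d` and off-diagonal entries `-√(η k)` at
`(k, k + 1)` and `(k + 1, k)`. -/
def symTriMatrix (n : ℕ) (d η : ℕ → ℝ) : Matrix (Fin n) (Fin n) ℝ :=
  triMatrix n d (fun k => √(η (k - 1))) (fun k => √(η k))

/-- The symmetric counterpart of a diagonal block of the followers' Laplacian with couplings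
`η`. -/
def symMatrix (n : ℕ) (η : ℕ → ℝ) : Matrix (Fin n) (Fin n) ℝ :=
  symTriMatrix n (fun k => 1 + η k) η

theorem symTriMatrix_isHermitian (n : ℕ) (d η : ℕ → ℝ) : (symTriMatrix n d η).IsHermitian := by
  refine Matrix.IsHermitian.ext fun i j => ?_
  rw [star_trivial]
  unfold symTriMatrix triMatrix
  rcases lt_trichotomy i.val j.val with h | h | h
  · by_cases h' : j.val = i.val + 1
    · simp [h']
      intro
      omega
    · simp [h.ne, h.ne', h', Ne.symm h', show i.val ≠ j.val + 1 by omega,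
        show j.val + 1 ≠ i.val by omega]
  · simp [h]
  · by_cases h' : i.val = j.val + 1
    · simp [h']
      intro
      omega
    · simp [h.ne, h.ne', h', Ne.symm h', show j.val ≠ i.val + 1 by omega,
        show i.val + 1 ≠ j.val by omega]

theorem pencil_symMatrix (n : ℕ) (η : ℕ → ℝ) (P Q : R) :
    P • (1 : Matrix (Fin n) (Fin n) R) + Q • (symMatrix n η).map (algebraMap ℝ R) =
      triMatrix n (fun k => P + algebraMap ℝ R (1 + η k) * Q)
        (fun k => algebraMap ℝ R √(η (k - 1)) * Q) (fun k => algebraMap ℝ R √(η k) * Q) := by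
  ext i j
  simp only [symMatrix, symTriMatrix, triMatrix, Matrix.add_apply, Matrix.smul_apply, Matrix.map_apply,
    smul_eq_mul, Matrix.one_apply, Fin.ext_iff]
  split_ifs <;> first | omega | (simp; try ring)

theorem continuant_pencil_symMatrix {η : ℕ → ℝ} (hη : ∀ k, 0 ≤ η k) (P Q : R) :
    continuant (fun k => P + algebraMap ℝ R (1 + η k) * Q)
      (fun k => algebraMap ℝ R √(η k) * Q * (algebraMap ℝ R √(η (k + 1 - 1)) * Q)) =
    pencilContinuant η P Q := by
  unfold pencilContinuant
  congr 1
  ext k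
  rw [Nat.add_sub_cancel, ← Real.mul_self_sqrt (hη k), map_mul, Real.mul_self_sqrt (hη k)]
  ring

theorem det_pencil_symMatrix (n : ℕ) {η : ℕ → ℝ} (hη : ∀ k, 0 ≤ η k) (P Q : R) :
    (P • (1 : Matrix (Fin n) (Fin n) R) + Q • (symMatrix n η).map (algebraMap ℝ R)).det =
      pencilContinuant η P Q 0 n := by
  rw [pencil_symMatrix, det_triMatrix, ← continuant_pencil_symMatrix hη]

end Pencil

/-! ### Diagonal entries of the resolvent -/

section Spectral

variable {n : Type*} [Fintype n] [DecidableEq n]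

theorem mem_spectrum_iff_det_eq_zero (A : Matrix n n ℝ) (μ : ℝ) :
    μ ∈ spectrum ℝ A ↔ (algebraMap ℝ (Matrix n n ℝ) μ - A).det = 0 := by
  rw [spectrum.mem_iff, Matrix.isUnit_iff_isUnit_det, isUnit_iff_ne_zero, not_not]

theorem posSemidef_sub_iff {A : Matrix n n ℝ} (hA : A.IsHermitian) (l : ℝ) :
    (algebraMap ℝ (Matrix n n ℝ) l - A).PosSemidef ↔ ∀ μ ∈ spectrum ℝ A, μ ≤ l := by
  rw [Matrix.posSemidef_iff_isHermitian_and_spectrum_nonneg, ← spectrum.singleton_sub_eq]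
  constructor
  · rintro ⟨-, h⟩ μ hμ
    have := h (Set.sub_mem_sub rfl hμ)
    simpa using this
  · refine fun h => ⟨?_, ?_⟩
    · refine Matrix.IsHermitian.sub ?_ hA
      rw [Algebra.algebraMap_eq_smul_one, Matrix.IsHermitian, Matrix.conjTranspose_smul,
        Matrix.conjTranspose_one, star_trivial]
    · rintro _ ⟨_, rfl, μ, hμ, rfl⟩
      simpa using h μ hμ

/-- The spectral theorem, as partial fractions for the diagonal entries of `(P + Q A)⁻¹`: their
residues `U c j ^ 2` are nonnegative and do not depend on `P` and `Q`. -/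
theorem exists_resolvent {A : Matrix n n ℝ} (hA : A.IsHermitian) :
    ∃ (U : Matrix n n ℝ) (ev : n → ℝ), (∀ j, ev j ∈ spectrum ℝ A) ∧
      ∀ P Q : ℂ, (∀ j, P + ev j * Q ≠ 0) → ∃ X : Matrix n n ℂ,
        (P • 1 + Q • A.map (algebraMap ℝ ℂ)) * X = 1 ∧
          ∀ c, X c c = ∑ j, ((U c j ^ 2 : ℝ) : ℂ) * (P + ev j * Q)⁻¹ := by
  set V : Matrix n n ℝ := (hA.eigenvectorUnitary : Matrix n n ℝ)
  have hVV : V * V.transpose = 1 := by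
    have := Unitary.coe_mul_star_self hA.eigenvectorUnitary
    rwa [Unitary.coe_star, Matrix.star_eq_conjTranspose,
      Matrix.conjTranspose_eq_transpose_of_trivial] at this
  have hVV' : V.transpose * V = 1 := by
    have := Unitary.coe_star_mul_self hA.eigenvectorUnitary
    rwa [Matrix.star_eq_conjTranspose, Matrix.conjTranspose_eq_transpose_of_trivial] at this
  have hdiag : A = V * Matrix.diagonal hA.eigenvalues * V.transpose := by
    have := hA.spectral_theorem
    rw [Unitary.conjStarAlgAut_apply, Matrix.star_eq_conjTranspose,
      Matrix.conjTranspose_eq_transpose_of_trivial] at this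
    simpa using this
  refine ⟨V, hA.eigenvalues, hA.eigenvalues_mem_spectrum_real, fun P Q hPQ => ?_⟩
  set f := algebraMap ℝ ℂ
  set W : Matrix n n ℂ := V.map f
  have hW : W * W.transpose = 1 := by
    have := congrArg (fun M : Matrix n n ℝ => M.map f) hVV
    simpa [Matrix.map_mul, W, Matrix.transpose_map] using this
  have hW' : W.transpose * W = 1 := by
    have := congrArg (fun M : Matrix n n ℝ => M.map f) hVV'
    simpa [Matrix.map_mul, W, Matrix.transpose_map] using this
  have hdiag' : A.map f = W * Matrix.diagonal (fun j => (hA.eigenvalues j : ℂ)) * W.transpose := by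
    have := congrArg (fun M : Matrix n n ℝ => M.map f) hdiag
    simp only [Matrix.map_mul, Matrix.transpose_map, Matrix.diagonal_map (map_zero f)] at this
    exact this
  have hpencil : P • 1 + Q • A.map f =
      W * Matrix.diagonal (fun j => P + hA.eigenvalues j * Q) * W.transpose := by
    have : Matrix.diagonal (fun j => P + (hA.eigenvalues j : ℂ) * Q) =
        P • (1 : Matrix n n ℂ) + Q • Matrix.diagonal (fun j => (hA.eigenvalues j : ℂ)) := by
      rw [Matrix.smul_one_eq_diagonal, ← Matrix.diagonal_smul, Matrix.diagonal_add]
      congr 1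
      ext j
      simp [mul_comm]
    rw [this, Matrix.mul_add, Matrix.add_mul, Matrix.mul_smul, Matrix.mul_smul, Matrix.smul_mul,
      Matrix.smul_mul, ← hdiag', Matrix.mul_one, hW]
  refine ⟨W * Matrix.diagonal (fun j => (P + hA.eigenvalues j * Q)⁻¹) * W.transpose, ?_, ?_⟩
  · rw [hpencil]
    calc _ = W * Matrix.diagonal (fun j => P + hA.eigenvalues j * Q) * (W.transpose * W) *
          Matrix.diagonal (fun j => (P + hA.eigenvalues j * Q)⁻¹) * W.transpose := by
          simp only [Matrix.mul_assoc]
      _ = W * (Matrix.diagonal (fun j => P + hA.eigenvalues j * Q) *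
          Matrix.diagonal (fun j => (P + hA.eigenvalues j * Q)⁻¹)) * W.transpose := by
          rw [hW', Matrix.mul_one, Matrix.mul_assoc W]
      _ = 1 := by
          rw [Matrix.diagonal_mul_diagonal]
          simp only [mul_inv_cancel₀ (hPQ _), Matrix.diagonal_one, Matrix.mul_one, hW]
  · intro c
    rw [Matrix.mul_apply]
    refine Finset.sum_congr rfl fun j _ => ?_
    rw [Matrix.mul_diagonal, Matrix.transpose_apply]
    simp [W, f]
    ring

/-- For `P + μ Q`, the inequality says `0 ≤ |P|² + 2 μ Re (P Q̄)`, which passes from a positive gain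
to any smaller one. -/
theorem mul_norm_le_of_le {l μ : ℝ} {P Q : ℂ} (hμ : 0 < μ) (hμl : μ ≤ l)
    (h : l * ‖Q‖ ≤ ‖P + l * Q‖) : μ * ‖Q‖ ≤ ‖P + μ * Q‖ := by
  have key : ∀ x : ℝ, ‖P + x * Q‖ ^ 2 =
      x ^ 2 * ‖Q‖ ^ 2 + ‖P‖ ^ 2 + 2 * x * (P.re * Q.re + P.im * Q.im) := by
    intro x
    simp only [← Complex.normSq_eq_norm_sq, Complex.normSq_apply]
    simp
    ring
  have h1 : (l * ‖Q‖) ^ 2 ≤ ‖P + l * Q‖ ^ 2 :=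
    pow_le_pow_left₀ (mul_nonneg (by linarith) (norm_nonneg _)) h 2
  refine (pow_le_pow_iff_left₀ (mul_nonneg hμ.le (norm_nonneg _)) (norm_nonneg _)
    two_ne_zero).1 ?_
  rw [key] at h1 ⊢
  rw [mul_pow] at h1 ⊢
  rcases le_total 0 (P.re * Q.re + P.im * Q.im) with h2 | h2
  · have := mul_nonneg (mul_nonneg zero_le_two hμ.le) h2
    have := sq_nonneg ‖P‖
    linarith
  · have := mul_le_mul_of_nonpos_right hμl h2
    linarith

theorem add_mul_ne_zero_of_le {μ : ℝ} {P Q : ℂ} (hμ : 0 < μ) (h0 : P ≠ 0 ∨ Q ≠ 0)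
    (h : μ * ‖Q‖ ≤ ‖P + μ * Q‖) : P + μ * Q ≠ 0 := by
  intro h1
  rw [h1, norm_zero] at h
  have hQ : Q = 0 := by
    rw [← norm_le_zero_iff]
    nlinarith
  rw [hQ, mul_zero, add_zero] at h1
  exact h0.elim (fun h => h h1) fun h => h hQ

end Spectral

/-- `det (p + H)` is a continuant, hence positive for every `p ≥ 0`. -/
theorem spectrum_symMatrix_pos {η : ℕ → ℝ} (hη : ∀ k, 0 ≤ η k) (n : ℕ) {μ : ℝ}
    (hμ : μ ∈ spectrum ℝ (symMatrix n η)) : 0 < μ := by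
  by_contra! hneg
  rw [mem_spectrum_iff_det_eq_zero] at hμ
  have h1 := det_pencil_symMatrix n hη (-μ) 1
  have h2 := pencilContinuant_pos hη (p := -μ) (by linarith) 0 n
  have h3 : (-μ) • (1 : Matrix (Fin n) (Fin n) ℝ) +
      (1 : ℝ) • (symMatrix n η).map (algebraMap ℝ ℝ) =
        -(algebraMap ℝ (Matrix (Fin n) (Fin n) ℝ) μ - symMatrix n η) := by
    rw [Algebra.algebraMap_eq_smul_one, Algebra.algebraMap_self, RingHom.coe_id, Matrix.map_id,
      one_smul, neg_smul]
    abel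
  rw [h3, Matrix.det_neg, hμ, mul_zero] at h1
  linarith

theorem pencilContinuant_mul_resolvent {η : ℕ → ℝ} (hη : ∀ k, 0 ≤ η k) {n : ℕ} {P Q : ℂ}
    {X : Matrix (Fin n) (Fin n) ℂ}
    (hX : (P • 1 + Q • (symMatrix n η).map (algebraMap ℝ ℂ)) * X = 1) {m : ℕ} (c : Fin n)
    (hc : c.val + m + 1 = n) :
    pencilContinuant η P Q 0 n * X c c =
      pencilContinuant η P Q 0 c * pencilContinuant η P Q (c + 1) m := by
  rw [pencil_symMatrix] at hX
  have hrow : ∀ i : Fin n, (triMatrix n (fun k => P + algebraMap ℝ ℂ (1 + η k) * Q)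
      (fun k => algebraMap ℝ ℂ √(η (k - 1)) * Q)
      (fun k => algebraMap ℝ ℂ √(η k) * Q)).mulVec (fun i => X i c) i =
        (fun k => if k = c.val then (1 : ℂ) else 0) i.val := fun i => by
    have := congrFun (congrFun hX i) c
    rw [Matrix.mul_apply, Matrix.one_apply] at this
    simpa only [Matrix.mulVec, dotProduct, Fin.ext_iff] using this
  have h := elim_at (r := fun k => if k = c.val then (1 : ℂ) else 0) hrow hc
    (by simp +contextual)
  rwa [continuant_pencil_symMatrix hη, pad_succ, if_pos rfl, one_mul] at h

/-- The diagonal entries of `Q (P + Q H)⁻¹` are dominated by those of `H⁻¹`. -/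
theorem norm_pencilContinuant_div_le {η : ℕ → ℝ} (hη : ∀ k, 0 ≤ η k) {n : ℕ} {l : ℝ}
    (hl : ∀ μ ∈ spectrum ℝ (symMatrix n η), μ ≤ l) {P Q : ℂ} (hPQ : l * ‖Q‖ ≤ ‖P + l * Q‖)
    (h0 : P ≠ 0 ∨ Q ≠ 0) :
    pencilContinuant η P Q 0 n ≠ 0 ∧ ∀ c m, c + m + 1 = n →
      ‖Q * (pencilContinuant η P Q 0 c * pencilContinuant η P Q (c + 1) m) /
          pencilContinuant η P Q 0 n‖ ≤
        pencilContinuant η (0 : ℝ) 1 0 c * pencilContinuant η (0 : ℝ) 1 (c + 1) m /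
          pencilContinuant η (0 : ℝ) 1 0 n := by
  obtain ⟨U, ev, hev, hres⟩ :=
    exists_resolvent (A := symMatrix n η) (symTriMatrix_isHermitian n _ η)
  have hpos : ∀ j, 0 < ev j := fun j => spectrum_symMatrix_pos hη n (hev j)
  have hle : ∀ j, ev j * ‖Q‖ ≤ ‖P + ev j * Q‖ := fun j =>
    mul_norm_le_of_le (hpos j) (hl _ (hev j)) hPQ
  have hne : ∀ j, P + ev j * Q ≠ 0 := fun j => add_mul_ne_zero_of_le (hpos j) h0 (hle j)
  obtain ⟨X, hX, hXd⟩ := hres P Q hne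
  obtain ⟨Y, hY, hYd⟩ := hres 0 1 fun j => by simpa using (hpos j).ne'
  have hK : pencilContinuant η P Q 0 n ≠ 0 := by
    have h1 := congrArg Matrix.det hX
    rw [Matrix.det_mul, det_pencil_symMatrix n hη, Matrix.det_one] at h1
    exact left_ne_zero_of_mul_eq_one h1
  refine ⟨hK, fun c m hc => ?_⟩
  have hXc := pencilContinuant_mul_resolvent hη hX ⟨c, by omega⟩ hc
  have hYc := pencilContinuant_mul_resolvent hη hY ⟨c, by omega⟩ hc
  simp only at hXc hYc
  have hreal : ∀ a m, pencilContinuant η (0 : ℂ) 1 a m =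
      (pencilContinuant η (0 : ℝ) 1 a m : ℝ) := fun a m => by
    have := map_pencilContinuant (Algebra.ofId ℝ ℂ) η 0 1 a m
    rw [map_zero, map_one] at this
    exact this.symm
  have hr0 := pencilContinuant_pos hη le_rfl 0 n
  have hYr : pencilContinuant η (0 : ℝ) 1 0 c * pencilContinuant η (0 : ℝ) 1 (c + 1) m /
      pencilContinuant η (0 : ℝ) 1 0 n = ∑ j, U ⟨c, by omega⟩ j ^ 2 * (ev j)⁻¹ := by
    rw [div_eq_iff hr0.ne', mul_comm (Finset.sum _ _)]
    rw [hYd, hreal, hreal, hreal] at hYc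
    simp only [zero_add, mul_one] at hYc
    exact_mod_cast hYc.symm
  rw [← hXc, mul_left_comm, mul_div_assoc, mul_div_cancel₀ _ hK, hYr, hXd, Finset.mul_sum]
  refine (norm_sum_le _ _).trans (Finset.sum_le_sum fun j _ => ?_)
  rw [norm_mul, norm_mul, norm_inv, Complex.norm_real, Real.norm_of_nonneg (sq_nonneg _),
    mul_left_comm]
  refine mul_le_mul_of_nonneg_left ?_ (sq_nonneg _)
  rw [← div_eq_mul_inv, div_le_iff₀ (norm_pos_iff.2 (hne j)), inv_mul_eq_div,
    le_div_iff₀ (hpos j), mul_comm]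
  exact hle j

/-! ### Rational functions on the imaginary axis -/

open Polynomial

theorem aeval_denom_ne_zero_of_div {p q : ℝ[X]} {s : ℂ} (hq : aeval s q ≠ 0) :
    aeval s (algebraMap ℝ[X] (RatFunc ℝ) p / algebraMap ℝ[X] (RatFunc ℝ) q).denom ≠ 0 := by
  obtain ⟨r, hr⟩ := RatFunc.denom_div_dvd p q
  intro h
  apply hq
  rw [hr, map_mul, h, zero_mul]

/-- The fraction need not be in lowest terms, and `q` may vanish at `s`. -/
theorem evalAt_mul_aeval {p q : ℝ[X]} (hq : q ≠ 0) {s : ℂ}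
    (hs : aeval s (algebraMap ℝ[X] (RatFunc ℝ) p / algebraMap ℝ[X] (RatFunc ℝ) q).denom ≠ 0) :
    evalAt (algebraMap ℝ[X] (RatFunc ℝ) p / algebraMap ℝ[X] (RatFunc ℝ) q) s * aeval s q =
      aeval s p := by
  have h := (RatFunc.num_mul_eq_mul_denom_iff
    (x := algebraMap ℝ[X] (RatFunc ℝ) p / algebraMap ℝ[X] (RatFunc ℝ) q) (p := p) hq).2 rfl
  have h' := congrArg (aeval s) h
  rw [map_mul, map_mul] at h'
  unfold evalAt RatFunc.eval
  rw [← aeval_def, ← aeval_def, div_mul_eq_mul_div, h', mul_div_cancel_right₀ _ hs]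

theorem evalAt_div {p q : ℝ[X]} {s : ℂ} (hq : aeval s q ≠ 0) :
    evalAt (algebraMap ℝ[X] (RatFunc ℝ) p / algebraMap ℝ[X] (RatFunc ℝ) q) s =
      aeval s p / aeval s q := by
  rw [eq_div_iff hq]
  refine evalAt_mul_aeval ?_ (aeval_denom_ne_zero_of_div hq)
  rintro rfl
  simp at hq

/-- `F` has no pole on the closed upper half of the imaginary axis, and its modulus there is
largest at `0`. -/
structure PeaksAtZero (F : RatFunc ℝ) : Prop where
  aeval_denom_ne_zero : ∀ ω : ℝ, 0 ≤ ω → aeval (Complex.I * (ω : ℂ)) F.denom ≠ 0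
  norm_evalAt_le : ∀ ω : ℝ, 0 ≤ ω → ‖evalAt F (Complex.I * (ω : ℂ))‖ ≤ ‖evalAt F 0‖

theorem hinfNorm_le_iff {F : RatFunc ℝ} {r : ℝ} (hr : 0 ≤ r) :
    hinfNorm F ≤ ENNReal.ofReal r ↔ ∀ ω : ℝ, 0 ≤ ω →
      aeval (Complex.I * (ω : ℂ)) F.denom ≠ 0 ∧ ‖evalAt F (Complex.I * (ω : ℂ))‖ ≤ r := by
  unfold hinfNorm
  rw [iSup₂_le_iff]
  refine forall₂_congr fun ω _ => ?_
  split_ifs with h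
  · simp [h]
  · rw [← ofReal_norm, ENNReal.ofReal_le_ofReal_iff hr]
    simp [h]

theorem le_hinfNorm_zero (F : RatFunc ℝ) : ‖evalAt F 0‖ₑ ≤ hinfNorm F := by
  unfold hinfNorm
  refine le_iSup₂_of_le (0 : ℝ) le_rfl ?_
  rw [Complex.ofReal_zero, mul_zero]
  split_ifs
  · exact le_top
  · exact le_rfl

namespace PeaksAtZero

variable {F G : RatFunc ℝ}

theorem hinfNorm_eq (hF : PeaksAtZero F) : hinfNorm F = ‖evalAt F 0‖ₑ := by
  refine le_antisymm ?_ (le_hinfNorm_zero F)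
  rw [← ofReal_norm, hinfNorm_le_iff (norm_nonneg _)]
  exact fun ω hω => ⟨hF.1 ω hω, hF.2 ω hω⟩

theorem zero : PeaksAtZero 0 := by
  constructor <;> simp [evalAt]

theorem const (x : ℝ) : PeaksAtZero (RatFunc.C x) := by
  constructor <;> simp [evalAt]

theorem evalAt_mul (hF : PeaksAtZero F) (hG : PeaksAtZero G) {ω : ℝ} (hω : 0 ≤ ω) :
    evalAt (F * G) (Complex.I * (ω : ℂ)) =
      evalAt F (Complex.I * (ω : ℂ)) * evalAt G (Complex.I * (ω : ℂ)) :=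
  RatFunc.eval_mul (algebraMap ℝ ℂ) _ (hF.1 ω hω) (hG.1 ω hω)

theorem evalAt_mul_zero (hF : PeaksAtZero F) (hG : PeaksAtZero G) :
    evalAt (F * G) 0 = evalAt F 0 * evalAt G 0 := by
  simpa using hF.evalAt_mul hG le_rfl

theorem mul (hF : PeaksAtZero F) (hG : PeaksAtZero G) : PeaksAtZero (F * G) := by
  refine ⟨fun ω hω h => ?_, fun ω hω => ?_⟩
  · obtain ⟨r, hr⟩ := RatFunc.denom_mul_dvd F G
    have h1 := congrArg (aeval (Complex.I * (ω : ℂ))) hr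
    rw [map_mul, map_mul, h, zero_mul] at h1
    exact mul_ne_zero (hF.1 ω hω) (hG.1 ω hω) h1
  · rw [hF.evalAt_mul hG hω, hF.evalAt_mul_zero hG, norm_mul, norm_mul]
    exact mul_le_mul (hF.2 ω hω) (hG.2 ω hω) (norm_nonneg _) (norm_nonneg _)

theorem hinfNorm_le_one (hF : PeaksAtZero F) {r : ℝ} (h : evalAt F 0 = r) (h0 : 0 ≤ r)
    (h1 : r ≤ 1) : hinfNorm F ≤ 1 := by
  rw [hF.hinfNorm_eq, h, ← ofReal_norm, Complex.norm_real, Real.norm_of_nonneg h0]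
  exact ENNReal.ofReal_le_one.2 h1

end PeaksAtZero

theorem peaksAtZero_div {p q : ℝ[X]} {r : ℝ}
    (hq : ∀ ω : ℝ, 0 ≤ ω → aeval (Complex.I * (ω : ℂ)) q ≠ 0)
    (hle : ∀ ω : ℝ, 0 ≤ ω →
      ‖aeval (Complex.I * (ω : ℂ)) p / aeval (Complex.I * (ω : ℂ)) q‖ ≤ r)
    (h0 : aeval (0 : ℂ) p / aeval (0 : ℂ) q = r) :
    PeaksAtZero (algebraMap ℝ[X] (RatFunc ℝ) p / algebraMap ℝ[X] (RatFunc ℝ) q) ∧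
      evalAt (algebraMap ℝ[X] (RatFunc ℝ) p / algebraMap ℝ[X] (RatFunc ℝ) q) 0 = r := by
  have hq0 := hq 0 le_rfl
  rw [Complex.ofReal_zero, mul_zero] at hq0
  have hev : evalAt (algebraMap ℝ[X] (RatFunc ℝ) p / algebraMap ℝ[X] (RatFunc ℝ) q) 0 = r := by
    rw [evalAt_div hq0, h0]
  refine ⟨⟨fun ω hω => aeval_denom_ne_zero_of_div (hq ω hω), fun ω hω => ?_⟩, hev⟩
  rw [evalAt_div (hq ω hω), hev, Complex.norm_real]
  exact (hle ω hω).trans (le_abs_self r)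

section Block

variable {η : ℕ → ℝ} {l : ℝ} {P Q : ℝ[X]}

theorem aeval_pencilContinuant (s : ℂ) (a m : ℕ) :
    aeval s (pencilContinuant η P Q a m) = pencilContinuant η (aeval s P) (aeval s Q) a m :=
  map_pencilContinuant _ _ _ _ _ _

/-- The entry with index `c` of the diagonal of `Q (P + Q H)⁻¹`, where `H` is the block of `c + m + 1`
rows of the symmetric tridiagonal matrix that starts at row `a`. -/
def resolventDiag (η : ℕ → ℝ) (P Q : ℝ[X]) (a c m : ℕ) : RatFunc ℝ :=
  algebraMap ℝ[X] (RatFunc ℝ)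
      (Q * (pencilContinuant η P Q a c * pencilContinuant η P Q (a + c + 1) m)) /
    algebraMap ℝ[X] (RatFunc ℝ) (pencilContinuant η P Q a (c + m + 1))

theorem peaksAtZero_block (hη : ∀ k, 0 ≤ η k) {a n : ℕ}
    (hl : ∀ μ ∈ spectrum ℝ (symMatrix n fun k => η (a + k)), μ ≤ l)
    (hPQ : ∀ ω : ℝ, 0 ≤ ω → l * ‖aeval (Complex.I * (ω : ℂ)) Q‖ ≤
      ‖aeval (Complex.I * (ω : ℂ)) P + l * aeval (Complex.I * (ω : ℂ)) Q‖)
    (hne : ∀ ω : ℝ, 0 ≤ ω →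
      aeval (Complex.I * (ω : ℂ)) P ≠ 0 ∨ aeval (Complex.I * (ω : ℂ)) Q ≠ 0)
    (hP : aeval (0 : ℂ) P = 0) :
    pencilContinuant η P Q a n ≠ 0 ∧ ∀ c m, c + m + 1 = n →
      PeaksAtZero (resolventDiag η P Q a c m) ∧
      evalAt (resolventDiag η P Q a c m) 0 =
        (pencilContinuant η (0 : ℝ) 1 a c * pencilContinuant η (0 : ℝ) 1 (a + c + 1) m /
          pencilContinuant η (0 : ℝ) 1 a n : ℝ) := by
  have key := fun (ω : ℝ) (hω : 0 ≤ ω) =>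
    norm_pencilContinuant_div_le (fun k => hη (a + k)) hl (hPQ ω hω) (hne ω hω)
  simp only [pencilContinuant_shift, add_zero, ← aeval_pencilContinuant, ← add_assoc] at key
  refine ⟨fun h => (key 0 le_rfl).1 (by rw [h, map_zero]), fun c m hc => ?_⟩
  subst hc
  refine peaksAtZero_div (fun ω hω => (key ω hω).1) (fun ω hω => ?_) ?_
  · rw [map_mul, map_mul]
    exact (key ω hω).2 c m rfl
  · have hQ : aeval (0 : ℂ) Q ≠ 0 := by
      have := hne 0 le_rfl
      rw [Complex.ofReal_zero, mul_zero] at this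
      exact this.resolve_left fun h => h hP
    have hr := (pencilContinuant_pos hη le_rfl a (c + m + 1)).ne'
    have hz := pencilContinuant_zero_left η (aeval (0 : ℂ) Q)
    simp only [map_mul, aeval_pencilContinuant, hP, hz]
    have hr' : ((pencilContinuant η (0 : ℝ) 1 a (c + m + 1) : ℝ) : ℂ) ≠ 0 := by exact_mod_cast hr
    simp only [Complex.coe_algebraMap]
    push_cast
    field_simp
    ring

end Block

/-! ### The Laplacian of the platoon -/

section Laplacian

variable {N : ℕ}

/-- The weights `ε` as a sequence, set to zero for the leader and from the last vehicle on, where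
they do not enter the Laplacian. -/
def coupling (ε : Fin N → ℝ) (k : ℕ) : ℝ :=
  if h : k ≠ 0 ∧ k + 1 < N then ε ⟨k, by omega⟩ else 0

theorem coupling_nonneg {ε : Fin N → ℝ} (hε : ∀ i, 0 ≤ ε i) (k : ℕ) : 0 ≤ coupling ε k := by
  unfold coupling
  split_ifs
  · exact hε _
  · exact le_rfl

theorem coupling_zero (ε : Fin N → ℝ) : coupling ε 0 = 0 := by
  simp [coupling]

theorem coupling_last (ε : Fin N → ℝ) {k : ℕ} (hk : N ≤ k + 1) : coupling ε k = 0 := by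
  unfold coupling
  rw [dif_neg]
  omega

/-- The diagonal of the Laplacian. -/
def laplacianDiag (ε : Fin N → ℝ) (k : ℕ) : ℝ := if k = 0 then 0 else 1 + coupling ε k

theorem laplacian_eq_triMatrix (ε : Fin N → ℝ) :
    laplacian ε = triMatrix N (laplacianDiag ε) (fun _ => 1) (coupling ε) := by
  ext i j
  unfold laplacian triMatrix laplacianDiag coupling
  have := j.2
  split_ifs <;> first | omega | simp

theorem algebraMap_sub_triMatrix (μ : ℝ) (d s t : ℕ → ℝ) :
    algebraMap ℝ (Matrix (Fin N) (Fin N) ℝ) μ - triMatrix N d s t =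
      triMatrix N (fun k => μ - d k) (fun k => -s k) (fun k => -t k) := by
  ext i j
  simp only [triMatrix, Matrix.sub_apply, Matrix.algebraMap_matrix_apply, Fin.ext_iff]
  split_ifs <;> first | omega | simp

/-- The characteristic polynomial of a tridiagonal matrix depends on its off-diagonal entries only
through the products of opposite ones. -/
theorem spectrum_symTriMatrix {ε : Fin N → ℝ} (hε : ∀ i, 0 ≤ ε i) :
    spectrum ℝ (symTriMatrix N (laplacianDiag ε) (coupling ε)) = spectrum ℝ (laplacian ε) := by
  ext μ
  rw [mem_spectrum_iff_det_eq_zero, mem_spectrum_iff_det_eq_zero, laplacian_eq_triMatrix,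
    symTriMatrix, algebraMap_sub_triMatrix, algebraMap_sub_triMatrix, det_triMatrix,
    det_triMatrix]
  simp only [neg_mul_neg, Nat.add_sub_cancel, mul_one,
    Real.mul_self_sqrt (coupling_nonneg hε _)]

theorem le_of_mem_spectrum_block {ε : Fin N → ℝ} (hε : ∀ i, 0 ≤ ε i) {l : ℝ}
    (hl : ∀ μ ∈ spectrum ℝ (laplacian ε), μ ≤ l) {a n : ℕ} (ha : 1 ≤ a) (han : a + n ≤ N) :
    ∀ μ ∈ spectrum ℝ (symMatrix n fun k => coupling ε (a + k)), μ ≤ l := by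
  rw [← spectrum_symTriMatrix hε, ← posSemidef_sub_iff (symTriMatrix_isHermitian N _ _)] at hl
  rw [← posSemidef_sub_iff (A := symMatrix n _) (symTriMatrix_isHermitian n _ _)]
  convert hl.submatrix (fun i : Fin n => (⟨a + i, by omega⟩ : Fin N)) using 1
  ext i j
  unfold symMatrix symTriMatrix
  rw [algebraMap_sub_triMatrix, algebraMap_sub_triMatrix]
  simp only [triMatrix, Matrix.submatrix_apply, laplacianDiag, add_assoc, add_right_inj]
  split_ifs <;> first | omega | rfl | skip
  rw [show a + (i.val - 1) = a + i.val - 1 by omega]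

end Laplacian

/-! ### The transfer functions of the platoon -/

namespace Agent

/-- The denominator `a p` of the open loop, not reduced. -/
def openDen (A : Agent) : ℝ[X] := A.vehDen * A.ctrlDen

/-- The numerator `b q` of the open loop, not reduced. -/
def openNum (A : Agent) : ℝ[X] := A.vehNum * A.ctrlNum

theorem openDen_ne_zero (A : Agent) : A.openDen ≠ 0 :=
  mul_ne_zero A.vehDen_ne_zero A.ctrlDen_ne_zero

theorem openLoop_eq (A : Agent) : A.openLoop =
    algebraMap ℝ[X] (RatFunc ℝ) A.openNum / algebraMap ℝ[X] (RatFunc ℝ) A.openDen := by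
  unfold openLoop controller vehicle openNum openDen
  rw [div_mul_div_comm, map_mul, map_mul, mul_comm, mul_comm (algebraMap _ _ A.ctrlDen)]

theorem aeval_openDen_zero {A : Agent} (h : 1 ≤ numIntegrators A.openLoop) :
    aeval (0 : ℂ) A.openDen = 0 := by
  have h1 : A.openLoop.denom.IsRoot 0 :=
    (rootMultiplicity_pos (RatFunc.denom_ne_zero _)).1 h
  rw [openLoop_eq] at h1
  have h2 := h1.dvd (RatFunc.denom_div_dvd _ _)
  have h3 := aeval_algebraMap_apply ℂ (0 : ℝ) A.openDen
  rwa [map_zero, coe_aeval_eq_eval, h2.eq_zero, map_zero] at h3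

end Agent

/-- A common zero of `a p` and `b q` would be a root of the characteristic polynomial. -/
theorem aeval_ne_zero_of_stable {N : ℕ} (hN : 2 ≤ N) {A : Agent} {ε : Fin N → ℝ}
    (hstab : AsymptoticallyStable A ε) {s : ℂ} (hs : 0 ≤ s.re) :
    aeval s A.openDen ≠ 0 ∨ aeval s A.openNum ≠ 0 := by
  by_contra! h
  obtain ⟨hP, hQ⟩ := h
  refine (hstab s ?_).not_ge hs
  have : Nonempty {i : Fin N // i.val ≠ 0} := ⟨⟨⟨1, by omega⟩, by simp⟩⟩
  unfold charPoly
  rw [AlgHom.map_det]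
  refine (congrArg Matrix.det ?_).trans (Matrix.det_zero)
  ext i j
  change aeval s (A.openDen * _ + A.openNum * _) = 0
  rw [map_add, map_mul, map_mul, hP, hQ, zero_mul, zero_mul, add_zero]

theorem norm_le_of_hinfNorm_closedLoop {A : Agent} {l : ℝ} (hP : aeval (0 : ℂ) A.openDen = 0)
    (hQ : aeval (0 : ℂ) A.openNum ≠ 0) (hnorm : hinfNorm (A.closedLoop l) = 1) (ω : ℝ)
    (hω : 0 ≤ ω) : l * ‖aeval (Complex.I * (ω : ℂ)) A.openNum‖ ≤
      ‖aeval (Complex.I * (ω : ℂ)) A.openDen + l * aeval (Complex.I * (ω : ℂ)) A.openNum‖ := by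
  have hq : A.openDen + C l * A.openNum ≠ 0 := by
    intro h
    have h1 := congrArg (aeval (0 : ℂ)) h
    rw [map_add, map_mul, hP, zero_add, map_zero, aeval_C] at h1
    have h2 : l = 0 := by simpa using (mul_eq_zero.1 h1).resolve_right hQ
    rw [h2, C_0, zero_mul, add_zero] at h
    exact A.openDen_ne_zero h
  have h := (hinfNorm_le_iff (F := A.closedLoop l) zero_le_one).1 (by simp [hnorm]) ω hω
  have h1 : evalAt (A.closedLoop l) (Complex.I * (ω : ℂ)) *
      aeval (Complex.I * (ω : ℂ)) (A.openDen + C l * A.openNum) =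
        aeval (Complex.I * (ω : ℂ)) (C l * A.openNum) := evalAt_mul_aeval hq h.1
  have h2 := congrArg norm h1
  rw [map_add, map_mul, aeval_C, norm_mul, norm_mul, Complex.coe_algebraMap,
    Complex.norm_real] at h2
  calc l * ‖aeval (Complex.I * (ω : ℂ)) A.openNum‖ ≤
      ‖l‖ * ‖aeval (Complex.I * (ω : ℂ)) A.openNum‖ := by
        gcongr
        exact le_abs_self l
    _ ≤ _ := by
        rw [← h2]
        exact mul_le_of_le_one_left (norm_nonneg _) h.2

section Transfer

variable {N : ℕ} {A : Agent} {ε : Fin N → ℝ}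

local notation "ι" => algebraMap ℝ[X] (RatFunc ℝ)

theorem algebraMap_pencilContinuant (η : ℕ → ℝ) (P Q : ℝ[X]) (a m : ℕ) :
    ι (pencilContinuant η P Q a m) = pencilContinuant η (ι P) (ι Q) a m :=
  map_pencilContinuant (IsScalarTower.toAlgHom ℝ ℝ[X] (RatFunc ℝ)) _ _ _ _ _

variable (A ε) in
/-- The determinant of the block of `a p + b q L` formed by the `m` rows from the follower with
index `a` on; meaningful for `1 ≤ a`. -/
def followerContinuant (a m : ℕ) : ℝ[X] :=
  pencilContinuant (coupling ε) A.openDen A.openNum a m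

variable (A ε) in
/-- The matrix `a p + b q L` of the platoon, leader included. -/
def systemMatrix : Matrix (Fin N) (Fin N) (RatFunc ℝ) :=
  triMatrix N (fun k => ι A.openDen + algebraMap ℝ (RatFunc ℝ) (laplacianDiag ε k) * ι A.openNum)
    (fun _ => ι A.openNum) (fun k => algebraMap ℝ (RatFunc ℝ) (coupling ε k) * ι A.openNum)

theorem systemMatrix_eq :
    systemMatrix A ε = ι A.openDen • (1 + A.openLoop • (laplacian ε).map RatFunc.C) := by
  have hP : ι A.openDen ≠ 0 := RatFunc.algebraMap_ne_zero A.openDen_ne_zero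
  rw [smul_add, smul_smul, A.openLoop_eq, mul_div_cancel₀ _ hP, laplacian_eq_triMatrix,
    ← RatFunc.algebraMap_eq_C]
  ext i j
  simp only [systemMatrix, triMatrix, Matrix.add_apply, Matrix.smul_apply, Matrix.map_apply,
    smul_eq_mul, Matrix.one_apply, Fin.ext_iff]
  split_ifs <;> first | omega | (simp; try ring)

variable (A ε) in
/-- The determinants of the contiguous blocks of `a p + b q L`, leader included. -/
def systemContinuant : ℕ → ℕ → RatFunc ℝ :=
  continuant
    (fun k => ι A.openDen + algebraMap ℝ (RatFunc ℝ) (laplacianDiag ε k) * ι A.openNum)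
    (fun k => algebraMap ℝ (RatFunc ℝ) (coupling ε k) * ι A.openNum * ι A.openNum)

theorem systemContinuant_follower {a : ℕ} (ha : 1 ≤ a) (m : ℕ) :
    systemContinuant A ε a m = ι (followerContinuant A ε a m) := by
  unfold followerContinuant
  rw [algebraMap_pencilContinuant]
  refine continuant_congr (fun k hk _ => ?_) fun k _ _ => ?_
  · rw [laplacianDiag, if_neg (by omega)]
  · ring

/-- The leader's row is decoupled, so it contributes the factor `a p`. -/
theorem systemContinuant_leader (m : ℕ) :
    systemContinuant A ε 0 (m + 1) = ι A.openDen * ι (followerContinuant A ε 1 m) := by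
  rw [← systemContinuant_follower le_rfl]
  unfold systemContinuant
  cases m with
  | zero => simp [continuant_one, continuant_zero, laplacianDiag]
  | succ m => simp [continuant_succ_succ, laplacianDiag, coupling_zero]

theorem systemMatrix_mulVec_transfer (hK : followerContinuant A ε 1 (N - 1) ≠ 0)
    (c i : Fin N) :
    (systemMatrix A ε).mulVec (fun o => transfer A ε c o) i =
      (fun k => if k = c.val then ι A.openNum else 0) i.val := by
  have hP : ι A.openDen ≠ 0 := RatFunc.algebraMap_ne_zero A.openDen_ne_zero
  have hdet : (systemMatrix A ε).det ≠ 0 := by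
    have h := det_triMatrix N
      (fun k => ι A.openDen + algebraMap ℝ (RatFunc ℝ) (laplacianDiag ε k) * ι A.openNum)
      (fun _ => ι A.openNum) (fun k => algebraMap ℝ (RatFunc ℝ) (coupling ε k) * ι A.openNum)
    have hN : systemContinuant A ε 0 N = systemContinuant A ε 0 (N - 1 + 1) :=
      congrArg _ (by have := c.2; omega)
    have h' : (systemMatrix A ε).det = systemContinuant A ε 0 N := h
    rw [h', hN, systemContinuant_leader]
    exact mul_ne_zero hP (RatFunc.algebraMap_ne_zero hK)
  have hunit : IsUnit (1 + A.openLoop • (laplacian ε).map RatFunc.C).det := by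
    rw [systemMatrix_eq, Matrix.det_smul] at hdet
    exact (right_ne_zero_of_mul hdet).isUnit
  have h : systemMatrix A ε * transferMatrix A ε = ι A.openNum • 1 := by
    rw [systemMatrix_eq, transferMatrix, Matrix.smul_mul, ← Matrix.mul_assoc,
      Matrix.mul_nonsing_inv _ hunit, Matrix.one_mul, smul_smul, A.openLoop_eq,
      mul_div_cancel₀ _ hP]
  have h1 := congrFun (congrFun h i) c
  rw [Matrix.mul_apply] at h1
  rw [Matrix.mulVec, dotProduct]
  refine h1.trans ?_
  simp [Matrix.one_apply, Fin.ext_iff]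

variable (A ε) in
/-- The transfer function from the input to the position of the follower with index `a + c`, in the
symmetrized platoon cut down to the `c + m + 1` followers from index `a` on. -/
def blockGain (a c m : ℕ) : RatFunc ℝ :=
  resolventDiag (coupling ε) A.openDen A.openNum a c m

theorem transfer_behind
    (hK : ∀ a m, 1 ≤ a → a + m ≤ N → followerContinuant A ε a m ≠ 0)
    {c i o : Fin N} (hio : i.val + 1 = o.val) (hco : c < o) {m : ℕ} (hm : o.val + m + 1 = N) :
    transfer A ε c o = blockGain A ε o 0 m * transfer A ε c i := by
  have hrow := systemMatrix_mulVec_transfer (hK 1 (N - 1) le_rfl (by have := c.2; omega)) c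
  have h := elim_backward (x := fun o => transfer A ε c o)
    (r := fun k => if k = c.val then ι A.openNum else 0) hrow hm
    (fun j hj => if_neg (by rw [Fin.lt_def] at hco; omega))
  change systemContinuant A ε o (m + 1) * _ = _ * systemContinuant A ε (o + 1) m * _ at h
  have hpad : pad (fun o => transfer A ε c o) o = transfer A ε c i := by
    rw [← hio, pad_succ]
  rw [systemContinuant_follower (by omega), systemContinuant_follower (by omega), pad_succ,
    hpad] at h
  have hne : ι (followerContinuant A ε o (m + 1)) ≠ 0 :=
    RatFunc.algebraMap_ne_zero (hK _ _ (by omega) (by omega))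
  unfold blockGain resolventDiag
  unfold followerContinuant at h hne
  rw [zero_add, div_mul_eq_mul_div, eq_div_iff hne, pencilContinuant_zero, one_mul, map_mul,
    add_zero, mul_comm]
  exact h

theorem transfer_leader
    (hK : ∀ a m, 1 ≤ a → a + m ≤ N → followerContinuant A ε a m ≠ 0)
    {c i : Fin N} (hi : i.val = 0) (hc : c.val ≠ 0) : transfer A ε c i = 0 := by
  have hN := c.2
  have hrow := systemMatrix_mulVec_transfer (hK 1 (N - 1) le_rfl (by have := c.2; omega)) c
  have h := elim_forward (x := fun o => transfer A ε c o)
    (r := fun k => if k = c.val then ι A.openNum else 0) hrow (k := 0) (by omega)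
    (fun j hj => if_neg (by omega))
  have hpad := pad_succ (fun o => transfer A ε c o) i
  rw [hi] at hpad
  rw [hpad, continuant_one, coupling_zero, map_zero, zero_mul, zero_mul, zero_mul, laplacianDiag,
    if_pos rfl, map_zero, zero_mul, add_zero] at h
  exact (mul_eq_zero.1 h).resolve_left (RatFunc.algebraMap_ne_zero A.openDen_ne_zero)

theorem transfer_ahead
    (hK : ∀ a m, 1 ≤ a → a + m ≤ N → followerContinuant A ε a m ≠ 0)
    {c i o : Fin N} (hio : i.val + 1 = o.val) (hoc : o ≤ c) {k : ℕ} (hk : i.val = k + 1) :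
    transfer A ε c i =
      RatFunc.C (coupling ε i) * blockGain A ε 1 k 0 * transfer A ε c o := by
  have hN := c.2
  rw [Fin.le_def] at hoc
  have hP : ι A.openDen ≠ 0 := RatFunc.algebraMap_ne_zero A.openDen_ne_zero
  have hrow := systemMatrix_mulVec_transfer (hK 1 (N - 1) le_rfl (by have := c.2; omega)) c
  have h := elim_forward (x := fun o => transfer A ε c o)
    (r := fun k => if k = c.val then ι A.openNum else 0) hrow i.2
    (fun j hj => if_neg (by omega))
  change systemContinuant A ε 0 (i + 1) * _ = _ * systemContinuant A ε 0 i * _ at h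
  have hpad : pad (fun o => transfer A ε c o) (i + 2) = transfer A ε c o := by
    rw [← pad_succ (fun o => transfer A ε c o) o, ← hio]
  rw [systemContinuant_leader, pad_succ, hpad, hk, systemContinuant_leader] at h
  have hne : ι (followerContinuant A ε 1 (k + 1)) ≠ 0 :=
    RatFunc.algebraMap_ne_zero (hK _ _ (by omega) (by omega))
  unfold blockGain resolventDiag
  unfold followerContinuant at h hne
  rw [add_zero, mul_assoc, div_mul_eq_mul_div, mul_div_assoc', eq_div_iff hne,
    pencilContinuant_zero, mul_one, map_mul, hk, ← RatFunc.algebraMap_eq_C]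
  apply mul_left_cancel₀ hP
  linear_combination h

theorem transfer_self
    (hK : ∀ a m, 1 ≤ a → a + m ≤ N → followerContinuant A ε a m ≠ 0)
    {c : Fin N} {k m : ℕ} (hk : c.val = k + 1) (hm : c.val + m + 1 = N) :
    transfer A ε c c = blockGain A ε 1 k m := by
  have hP : ι A.openDen ≠ 0 := RatFunc.algebraMap_ne_zero A.openDen_ne_zero
  have hrow := systemMatrix_mulVec_transfer (hK 1 (N - 1) le_rfl (by have := c.2; omega)) c
  have h := elim_at (x := fun o => transfer A ε c o)
    (r := fun k => if k = c.val then ι A.openNum else 0) hrow hm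
    (fun j hj => if_neg hj)
  change systemContinuant A ε 0 N * _ =
    _ * systemContinuant A ε 0 c * systemContinuant A ε (c + 1) m at h
  have hN : systemContinuant A ε 0 N = systemContinuant A ε 0 (k + m + 1 + 1) :=
    congrArg _ (by omega)
  rw [hN, systemContinuant_leader, pad_succ, hk, systemContinuant_leader,
    systemContinuant_follower (by omega), if_pos rfl] at h
  have hne : ι (followerContinuant A ε 1 (k + m + 1)) ≠ 0 :=
    RatFunc.algebraMap_ne_zero (hK _ _ (by omega) (by omega))
  unfold blockGain resolventDiag
  unfold followerContinuant at h hne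
  rw [eq_div_iff hne, map_mul, map_mul, add_comm 1 k]
  apply mul_left_cancel₀ hP
  linear_combination h

end Transfer

end Platoon

end

theorem theorem3 (N : ℕ) (A : Platoon.Agent) (ε : Fin N → ℝ)
    (hε : ∀ i, 0 ≤ ε i)
    (hint : 1 ≤ Platoon.numIntegrators A.openLoop)
    (hstab : Platoon.AsymptoticallyStable A ε)
    (lmax : ℝ) (hlmax : ∀ μ ∈ spectrum ℝ (Platoon.laplacian ε), μ ≤ lmax)
    (hnorm : Platoon.hinfNorm (A.closedLoop lmax) = 1) :
    (∀ c o : Fin N, c.val ≠ 0 →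
      Platoon.hinfNorm (Platoon.transfer A ε c o) =
        ‖Platoon.evalAt (Platoon.transfer A ε c o) 0‖ₑ) ∧
    Platoon.BidirectionallyStringStable A ε := by
  have hη := Platoon.coupling_nonneg hε
  have hP := Platoon.Agent.aeval_openDen_zero hint
  -- With at most one vehicle there is no follower and no pair of neighbours.
  by_cases hN : 2 ≤ N
  swap
  · refine ⟨fun c _ hc => absurd c.2 (by omega), fun c i o hio => ?_⟩
    exact absurd o.2 (by omega)
  have hne : ∀ ω : ℝ, 0 ≤ ω → Polynomial.aeval (Complex.I * (ω : ℂ)) A.openDen ≠ 0 ∨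
      Polynomial.aeval (Complex.I * (ω : ℂ)) A.openNum ≠ 0 := fun ω _ =>
    Platoon.aeval_ne_zero_of_stable hN hstab (by simp)
  have hQ : Polynomial.aeval (0 : ℂ) A.openNum ≠ 0 :=
    (Platoon.aeval_ne_zero_of_stable hN hstab (by simp)).resolve_left fun h => h hP
  have hblock := fun (a n : ℕ) (ha : 1 ≤ a) (han : a + n ≤ N) =>
    Platoon.peaksAtZero_block hη (Platoon.le_of_mem_spectrum_block hε hlmax ha han)
      (Platoon.norm_le_of_hinfNorm_closedLoop hP hQ hnorm) hne hP
  have hK : ∀ a m, 1 ≤ a → a + m ≤ N → Platoon.followerContinuant A ε a m ≠ 0 :=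
    fun a m ha ham => (hblock a m ha ham).1
  have hgain : ∀ a c m, 1 ≤ a → a + c + m + 1 ≤ N → Platoon.PeaksAtZero
      (Platoon.blockGain A ε a c m) := fun a c m ha h =>
    ((hblock a (c + m + 1) ha (by omega)).2 c m rfl).1
  have hself : ∀ c : Fin N, c.val ≠ 0 → Platoon.PeaksAtZero (Platoon.transfer A ε c c) := by
    intro c hc
    rw [Platoon.transfer_self hK (k := c.val - 1) (m := N - c.val - 1) (by omega) (by omega)]
    exact hgain _ _ _ le_rfl (by omega)
  refine ⟨fun c o hc => ?_, fun c i o hio => ⟨fun hco => ?_, fun hoc => ?_⟩⟩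
  · apply Platoon.PeaksAtZero.hinfNorm_eq
    rcases le_total c o with hco | hoc
    · obtain ⟨o, ho⟩ := o
      induction o with
      | zero => exact absurd (Fin.le_def.1 hco) (by simpa using hc)
      | succ k ih =>
        rcases hco.eq_or_lt with rfl | hlt
        · exact hself _ hc
        · rw [Platoon.transfer_behind hK (i := ⟨k, by omega⟩) (m := N - k - 2) rfl hlt
            (by simp; omega)]
          refine (hgain _ _ _ (by simp) (by simp; omega)).mul (ih _ ?_)
          rw [Fin.lt_def] at hlt
          rw [Fin.le_def]
          exact Nat.le_of_lt_succ hlt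
    · obtain ⟨d, hd⟩ := Nat.exists_eq_add_of_le (Fin.le_def.1 hoc)
      induction d generalizing o with
      | zero =>
        obtain rfl : c = o := Fin.ext hd
        exact hself c hc
      | succ d ih =>
        by_cases ho : o.val = 0
        · rw [Platoon.transfer_leader hK ho hc]
          exact Platoon.PeaksAtZero.zero
        · have hc2 := c.2
          rw [Platoon.transfer_ahead hK (o := ⟨o.val + 1, by omega⟩) (k := o.val - 1) rfl
            (Fin.le_def.2 (by simp; omega)) (by omega)]
          exact ((Platoon.PeaksAtZero.const _).mul (hgain _ _ _ le_rfl (by omega))).mul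
            (ih _ (Fin.le_def.2 (by simp; omega)) (by simp; omega))
  · have ho := o.2
    have h := Platoon.transfer_behind hK hio hco (m := N - o.val - 1) (by omega)
    unfold Platoon.ratioNorm
    split_ifs with h1 h2
    · simp
    · rw [h1, mul_zero] at h
      exact absurd h h2
    · rw [h, mul_div_cancel_right₀ _ h1]
      have hv := ((hblock o.val _ (by omega) (by omega)).2 0 (N - o.val - 1) rfl).2
      -- Blocks that reach the last vehicle, whose coupling is zero, have determinant `1`.
      have hlast : ∀ a m, a + m = N → Platoon.pencilContinuant (Platoon.coupling ε) (0 : ℝ) 1 a m =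
          1 := by
        intro a m ham
        cases m with
        | zero => exact Platoon.pencilContinuant_zero _ _ _ _
        | succ m =>
          rw [Platoon.pencilContinuant_zero_one_succ, Platoon.coupling_last ε (by omega), zero_mul,
            add_zero]
      rw [hlast _ (0 + _ + 1) (by omega), hlast (o.val + 0 + 1) _ (by omega),
        Platoon.pencilContinuant_zero, mul_one, div_one] at hv
      exact (hgain _ _ _ (by omega) (by omega)).hinfNorm_le_one hv zero_le_one le_rfl
  · have hc := c.2
    have hc' := Fin.le_def.1 hoc
    by_cases hi : i.val = 0
    · rw [Platoon.transfer_leader hK hi (by omega)]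
      unfold Platoon.ratioNorm
      rw [if_pos rfl, zero_div, Platoon.PeaksAtZero.zero.hinfNorm_eq]
      split_ifs <;> simp [Platoon.evalAt]
    · obtain ⟨k, hk⟩ := Nat.exists_eq_succ_of_ne_zero hi
      have h := Platoon.transfer_ahead hK hio hoc hk
      unfold Platoon.ratioNorm
      split_ifs with h1 h2
      · simp
      · rw [h1, mul_zero] at h
        exact absurd h h2
      · rw [h, mul_div_cancel_right₀ _ h1]
        have hconst := Platoon.PeaksAtZero.const (Platoon.coupling ε i)
        have hg := hgain 1 k 0 le_rfl (by omega)
        have hv := ((hblock 1 _ le_rfl (by omega)).2 k 0 rfl).2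
        have hpos := Platoon.pencilContinuant_pos hη (le_refl (0 : ℝ)) 1 k
        have hi' := hη i
        rw [add_zero, Platoon.pencilContinuant_zero_one_succ, Platoon.pencilContinuant_zero,
          mul_one, add_comm 1 k, ← Nat.succ_eq_add_one, ← hk] at hv
        have hev := hconst.evalAt_mul_zero hg
        have hC : Platoon.evalAt (RatFunc.C (Platoon.coupling ε i)) 0 =
            (Platoon.coupling ε i : ℝ) := by simp [Platoon.evalAt]
        unfold Platoon.blockGain at hev hg
        rw [hv, hC, ← Complex.ofReal_mul] at hev
        have hden : 0 < 1 + Platoon.coupling ε i *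
            Platoon.pencilContinuant (Platoon.coupling ε) (0 : ℝ) 1 1 k := by positivity
        refine (hconst.mul hg).hinfNorm_le_one hev (by positivity) ?_
        rw [mul_div_assoc', div_le_one hden]
        linarith
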